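/- Let $N\ge 2$ be an integer and let $T_N$ denote the map $x\mapsto Nx \bmod 1$ on $[0,1]$ and also the map $(x_1,x_2)\mapsto (Nx_1 \bmod 1, Nx_2\bmod 1)$ on $[0,1]^2$, where $\bmod\ 1$ takes values in $[0,1)$. For a Borel probability measure $\mu$ on a metric space, let $\dim_H\mu=\inf\{\dim_H A:\ A \text{ Borel},\ \mu(A)>0\}$ be its (lower) Hausdorff dimension. For $v=(v_1,v_2)\in\mathbb R^2$ let $P_v\mu$ be the push-forward of $\mu$ under $P_v(x)=\langle x,v\rangle = x_1v_1+x_2v_2$, and call $v$ non-principal if $v_1v_2\ne 0$. Let $\lambda$ be Lebesgue measure on $[0,1]$. Let $\mu$ be a $T_N$-invariant and ergodic Borel probability measure on $[0,1]^2$ with $\dim_H\mu=1$. Then the following are equivalent: 1. $\dim_H P_v\mu=1$ (that is, $\dim_H P_v\mu=\dim_H\mu$) for all non-principal $v\in\mathbb R^2$; 2. $\mu=\nu\times\lambda$ or $\mu=\lambda\times\nu$ for some $T_N$-invariant and ergodic Borel probability measure $\nu$ on $[0,1]$ with $\dim_H\nu=0$. -/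

import Mathlib

open MeasureTheory
open scoped ENNReal unitInterval

namespace TimesN

/-- The map `x ↦ N x mod 1` on `[0,1]`, where `mod 1` takes values in `[0,1)`. -/
noncomputable def timesMap (N : ℕ) (x : I) : I :=
  ⟨Int.fract ((N : ℝ) * (x : ℝ)), Int.fract_nonneg _, (Int.fract_lt_one _).le⟩

/-- The map `(x₁, x₂) ↦ (N x₁ mod 1, N x₂ mod 1)` on `[0,1]²`. -/
noncomputable def timesMap₂ (N : ℕ) (x : I × I) : I × I :=
  (timesMap N x.1, timesMap N x.2)

/-- The projection `P_v(x) = ⟨x, v⟩`, as a map from `[0,1]²` to `ℝ`. -/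
def proj (v : ℝ × ℝ) (x : I × I) : ℝ :=
  (x.1 : ℝ) * v.1 + (x.2 : ℝ) * v.2

/-- A vector of the plane is non-principal if it lies on neither coordinate axis. -/
def NonPrincipal (v : ℝ × ℝ) : Prop :=
  v.1 * v.2 ≠ 0

/-- The (lower) Hausdorff dimension of a Borel measure: the infimum of the Hausdorff dimensions
of the Borel sets of positive measure. On `[0,1]²` Mathlib's metric is the maximum metric; it is
bi-Lipschitz equivalent to the Euclidean one, so both give the same Hausdorff dimensions. -/
noncomputable def measureDimH {X : Type*} [EMetricSpace X] [MeasurableSpace X] [BorelSpace X]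
    (μ : Measure X) : ℝ≥0∞ :=
  ⨅ (A : Set X) (_ : MeasurableSet A) (_ : 0 < μ A), dimH A

theorem measurable_timesMap (N : ℕ) : Measurable (timesMap N) :=
  (measurable_fract.comp (measurable_subtype_coe.const_mul (N : ℝ))).subtype_mk

theorem measurable_timesMap₂ (N : ℕ) : Measurable (timesMap₂ N) :=
  ((measurable_timesMap N).comp measurable_fst).prodMk
    ((measurable_timesMap N).comp measurable_snd)

theorem measurable_proj (v : ℝ × ℝ) : Measurable (proj v) := by
  unfold proj
  fun_prop

end TimesN

/-! Let μ₁, μ₂ be the marginals of μ. Statement 1 is only needed for integer vectors v = (p, q) with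
pq ≠ 0. The measure P_vμ mod 1 is T_N-invariant and charges no set of dimension below one, and λ is
the only such invariant probability measure (`exists_dimH_lt_one_of_ne_volume`). So every Fourier
coefficient of μ off the axes vanishes, which means μ + λ×λ = μ₁×λ + λ×μ₂
(`add_prod_eq_of_integral_fourier`). If neither marginal were λ, ergodicity would put each on a
λ-null set, and the product of these sets would have mass one on the left and zero on the right. So
one marginal is λ, its terms cancel, and μ is a product; slicing gives the other factor dimension 0.

Uniqueness of λ is a counting argument: digits that are not uniform force, on a set of positive
measure, infinitely many initial words into an exponentially small share of all words.

Conversely, by Fubini P_v(ν×λ) is absolutely continuous once v₂ ≠ 0. -/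

namespace TimesN

open Filter Topology Set

/-! ### Hausdorff dimension through covers. -/

section Covers

variable {X : Type*} [EMetricSpace X]

/-- A set covered infinitely often by a sequence of families with summable `s`-th powers of
diameters has Hausdorff dimension at most `s`. -/
theorem dimH_le_of_frequently_mem_cover {s : NNReal} (hs : 0 < s) {A : Set X}
    (U : ℕ → ℕ → Set X) (hU : ∑' n, ∑' i, Metric.ediam (U n i) ^ (s : ℝ) ≠ ⊤)
    (hA : ∀ x ∈ A, ∃ᶠ n in atTop, ∃ i, x ∈ U n i) : dimH A ≤ s := by
  borelize X
  have hs' : (0 : ℝ) < s := hs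
  let c : ℕ → ℝ≥0∞ := fun n => ∑' i, Metric.ediam (U n i) ^ (s : ℝ)
  let tail : ℕ → ℝ≥0∞ := fun n => ∑' k, c (k + n)
  have htail : Tendsto tail atTop (𝓝 0) := ENNReal.tendsto_sum_nat_add c hU
  have hle : ∀ n, ∀ p : ℕ × ℕ, Metric.ediam (U (p.1 + n) p.2) ^ (s : ℝ) ≤ tail n := fun n p =>
    (ENNReal.le_tsum (f := fun i => Metric.ediam (U (p.1 + n) i) ^ (s : ℝ)) p.2).trans
      (ENNReal.le_tsum (f := fun k => c (k + n)) p.1)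
  -- The families of index at least n still cover A, and each of their sets has diameter at most
  -- `tail n ^ (1 / s)`, which tends to 0.
  have key := Measure.hausdorffMeasure_le_liminf_tsum (s : ℝ) A (l := atTop)
    (fun n => tail n ^ (1 / (s : ℝ)))
    (by
      have := htail.ennrpow_const (1 / (s : ℝ))
      rwa [ENNReal.zero_rpow_of_pos (by positivity)] at this)
    (fun (n : ℕ) (p : ℕ × ℕ) => U (p.1 + n) p.2)
    (Eventually.of_forall fun n p => by
      rw [one_div, ENNReal.le_rpow_inv_iff hs']
      exact hle n p)
    (Eventually.of_forall fun n x hx => by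
      obtain ⟨m, hm, i, hi⟩ := (frequently_atTop.1 (hA x hx)) n
      exact mem_iUnion.2 ⟨(m - n, i), by simpa [Nat.sub_add_cancel hm] using hi⟩)
  have h2 : (fun n => ∑' p : ℕ × ℕ, Metric.ediam (U (p.1 + n) p.2) ^ (s : ℝ)) = tail := by
    funext n
    exact ENNReal.tsum_prod' (f := fun p : ℕ × ℕ => Metric.ediam (U (p.1 + n) p.2) ^ (s : ℝ))
  rw [h2, htail.liminf_eq] at key
  refine dimH_le_of_hausdorffMeasure_ne_top (d := s) ?_
  exact (key.trans_lt ENNReal.zero_lt_top).ne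

theorem exists_cover_of_dimH_lt {s : NNReal} (hs : 0 < s) {A : Set X} (hA : dimH A < s)
    {ε : ℝ≥0∞} (hε : ε ≠ 0) :
    ∃ U : ℕ → Set X, A ⊆ ⋃ i, U i ∧ ∑' i, Metric.ediam (U i) ^ (s : ℝ) < ε := by
  borelize X
  have hs' : (0 : ℝ) < s := hs
  have h0 := hausdorffMeasure_of_dimH_lt hA
  rw [Measure.hausdorffMeasure_apply] at h0
  have h1 := (iSup_eq_bot.1 ((iSup_eq_bot.1 h0) 1)) one_pos
  have h2 : _ < ε := (lt_of_le_of_lt (le_of_eq h1) (pos_iff_ne_zero.2 hε))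
  simp only [iInf_lt_iff] at h2
  obtain ⟨U, hU, -, h⟩ := h2
  refine ⟨U, hU, lt_of_le_of_lt (ENNReal.tsum_le_tsum fun i => ?_) h⟩
  rcases (U i).eq_empty_or_nonempty with h | h
  · simp [h, ENNReal.zero_rpow_of_pos hs']
  · exact le_iSup_of_le h le_rfl

end Covers

/-! ### Slices of planar sets, and the dimension of λ×ν. -/

theorem volume_le_ediam (s : Set I) : volume s ≤ Metric.ediam s := by
  rw [unitInterval.volume_apply]
  exact (Real.volume_le_diam _).trans_eq (isometry_subtype_coe.ediam_image s)

theorem volume_eq_zero_of_dimH_lt_one {A : Set I} (hA : dimH A < 1) : volume A = 0 := by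
  rw [unitInterval.volume_apply, ← hausdorffMeasure_real]
  have := hausdorffMeasure_of_dimH_lt (X := ℝ) (s := Subtype.val '' A) (d := 1)
    (by rw [isometry_subtype_coe.dimH_image]; simpa using hA)
  simpa using this

/-- Slicing: almost every vertical slice of a planar set of dimension less than `1 + t` has
dimension at most `t`. -/
theorem ae_dimH_slice_le {t : NNReal} (ht : 0 < t) {A : Set (I × I)} (hA : dimH A < 1 + t) :
    ∀ᵐ x : I, dimH {y | (x, y) ∈ A} ≤ t := by
  have ht' : (0 : ℝ) < t := ht
  obtain ⟨ε, hε, hεs⟩ := ENNReal.exists_pos_sum_of_countable one_ne_zero ℕ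
  have hcov : ∀ n, ∃ U : ℕ → Set (I × I), A ⊆ ⋃ i, U i ∧
      ∑' i, Metric.ediam (U i) ^ ((1 + t : NNReal) : ℝ) < ε n := fun n =>
    exists_cover_of_dimH_lt (by positivity) (by simpa using hA)
      (by simpa using (hε n).ne')
  choose U hAU hU using hcov
  -- Taking the closure makes the shadow measurable without enlarging its diameter.
  let K : ℕ → ℕ → Set I := fun n i => closure (Prod.fst '' U n i)
  let g : I → ℝ≥0∞ := fun x =>
    ∑' n, ∑' i, (K n i).indicator (fun _ => Metric.ediam (U n i) ^ (t : ℝ)) x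
  have hm : ∀ n i, Measurable ((K n i).indicator
      (fun _ => Metric.ediam (U n i) ^ (t : ℝ))) := fun n i =>
    measurable_const.indicator isClosed_closure.measurableSet
  have hgm : Measurable g := Measurable.tsum fun n => Measurable.tsum fun i => hm n i
  have hK : ∀ n i, volume (K n i) ≤ Metric.ediam (U n i) := fun n i =>
    (volume_le_ediam _).trans (by
      rw [Metric.ediam_closure]
      have := (LipschitzWith.prod_fst (α := I) (β := I)).ediam_image_le (U n i)
      simpa using this)
  have hg : ∫⁻ x, g x ≠ ⊤ := by
    refine ne_of_lt (lt_of_le_of_lt ?_ ENNReal.one_lt_top)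
    simp only [g]
    rw [lintegral_tsum fun n => (Measurable.tsum fun i => hm n i).aemeasurable]
    refine le_trans (ENNReal.tsum_le_tsum fun n => ?_) hεs.le
    rw [lintegral_tsum fun i => (hm n i).aemeasurable]
    refine le_trans (ENNReal.tsum_le_tsum fun i => ?_) (hU n).le
    -- In diam^(1+t) = diam · diam^t, the first factor bounds the length of the shadow and the
    -- second is the value of the indicator.
    rw [lintegral_indicator_const isClosed_closure.measurableSet, NNReal.coe_add, NNReal.coe_one,
      ENNReal.rpow_add_of_nonneg _ _ zero_le_one ht'.le, ENNReal.rpow_one, mul_comm]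
    gcongr
    exact hK n i
  filter_upwards [ae_lt_top hgm hg] with x hx
  refine dimH_le_of_frequently_mem_cover ht (fun n i => {y | (x, y) ∈ U n i})
    (ne_of_lt (lt_of_le_of_lt (ENNReal.tsum_le_tsum fun n => ENNReal.tsum_le_tsum fun i => ?_) hx))
    fun y hy => (Eventually.of_forall fun n => by
      simpa using hAU n hy).frequently
  by_cases hxK : x ∈ K n i
  · rw [indicator_of_mem hxK]
    gcongr
    refine Metric.ediam_le fun y hy z hz => ?_
    refine le_trans ?_ (Metric.edist_le_ediam_of_mem (s := U n i) hy hz)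
    simp [Prod.edist_eq]
  · have : {y | (x, y) ∈ U n i} = ∅ := by
      ext y
      simp only [mem_ofPred_eq, mem_empty_iff_false, iff_false]
      exact fun h => hxK (subset_closure ⟨_, h, rfl⟩)
    rw [this]
    simp [ENNReal.zero_rpow_of_pos ht']

/-- If 0 < t < dim ν, a set of dimension below 1 + t has almost all slices of dimension at most t,
hence ν-null, so it is null for the product by Fubini. -/
theorem measureDimH_eq_zero_of_volume_prod {ν : Measure I} [SFinite ν]
    (h : measureDimH ((volume : Measure I).prod ν) ≤ 1) : measureDimH ν = 0 := by
  by_contra hne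
  obtain ⟨t, ht0, ht⟩ := ENNReal.lt_iff_exists_nnreal_btwn.1 (pos_iff_ne_zero.2 hne)
  have ht0' : 0 < t := by exact_mod_cast ht0
  have h1 : measureDimH ((volume : Measure I).prod ν) < 1 + t := by
    exact h.trans_lt (ENNReal.lt_add_right ENNReal.one_ne_top ht0.ne')
  simp only [measureDimH, iInf_lt_iff] at h1
  obtain ⟨A, hAm, hA, hAd⟩ := h1
  refine hA.ne' ((Measure.measure_prod_null hAm).2 ?_)
  filter_upwards [ae_dimH_slice_le ht0' hAd] with x hx
  by_contra hpos
  refine absurd (hx.trans_lt ht) (not_lt.2 ?_)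
  exact iInf₂_le_of_le _ (measurable_prodMk_left hAm) (iInf_le _ (pos_iff_ne_zero.2 hpos))

theorem measureDimH_map_isometryEquiv {X Y : Type*} [EMetricSpace X] [MeasurableSpace X]
    [BorelSpace X] [EMetricSpace Y] [MeasurableSpace Y] [BorelSpace Y] (e : X ≃ᵢ Y)
    (μ : Measure X) : measureDimH μ ≤ measureDimH (μ.map e) := by
  refine le_iInf fun A => le_iInf₂ fun hA hpos => ?_
  rw [Measure.map_apply e.continuous.measurable hA] at hpos
  rw [← e.dimH_preimage A]
  exact iInf₂_le_of_le _ (e.continuous.measurable hA) (iInf_le _ hpos)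

/-! ### Base-M digits and weights of words. -/

section Digits

theorem fract_intCast_mul_fract (p : ℤ) (y : ℝ) :
    Int.fract ((p : ℝ) * Int.fract y) = Int.fract (p * y) := by
  rw [Int.fract_eq_fract]
  exact ⟨-(p * ⌊y⌋), by push_cast; rw [Int.fract]; ring⟩

theorem fract_natCast_mul_fract (p : ℕ) (y : ℝ) :
    Int.fract ((p : ℝ) * Int.fract y) = Int.fract (p * y) := by
  simpa using fract_intCast_mul_fract p y

theorem coe_timesMap (N : ℕ) (x : I) : (timesMap N x : ℝ) = Int.fract ((N : ℝ) * x) := rfl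

/-- Exponent 0 is excluded: the zeroth iterate fixes the point 1, while `timesMap 1` sends it to 0.
-/
theorem timesMap_iterate_succ (N n : ℕ) : (timesMap N)^[n + 1] = timesMap (N ^ (n + 1)) := by
  induction n with
  | zero => simp
  | succ n ih =>
    rw [Function.iterate_succ', ih]
    funext x
    ext
    rw [Function.comp_apply, coe_timesMap, coe_timesMap, fract_natCast_mul_fract, coe_timesMap,
      ← mul_assoc, pow_succ' N (n + 1)]
    push_cast
    rfl

theorem lt_one_of_ne {x : I} (hx : x ≠ 1) : (x : ℝ) < 1 :=
  lt_of_le_of_ne x.2.2 fun h => hx (Subtype.ext h)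

theorem coe_timesMap_iterate (N n : ℕ) {x : I} (hx : x ≠ 1) :
    ((timesMap N)^[n] x : ℝ) = Int.fract ((N : ℝ) ^ n * x) := by
  cases n with
  | zero => simpa using (Int.fract_eq_self.2 ⟨x.2.1, lt_one_of_ne hx⟩).symm
  | succ n => rw [timesMap_iterate_succ, coe_timesMap]; push_cast; rfl

/-- The leading digit of `x` in base `M`. -/
noncomputable def digit (M : ℕ) (x : I) : ℕ := ⌊(M : ℝ) * x⌋₊

theorem measurable_digit (M : ℕ) : Measurable (digit M) :=
  Nat.measurable_floor.comp (measurable_subtype_coe.const_mul (M : ℝ))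

/-- The product of the weights of the last `k` digits of `i` in base `M`. -/
noncomputable def wordWeight (M : ℕ) (w : ℕ → ℝ) : ℕ → ℕ → ℝ
  | 0, _ => 1
  | k + 1, i => wordWeight M w k (i / M) * w (i % M)

theorem wordWeight_nonneg {M : ℕ} {w : ℕ → ℝ} (hw : ∀ d, 0 ≤ w d) (k i : ℕ) :
    0 ≤ wordWeight M w k i := by
  induction k generalizing i with
  | zero => exact zero_le_one
  | succ k ih => exact mul_nonneg (ih _) (hw _)

theorem sum_wordWeight {M : ℕ} (hM : 0 < M) (w : ℕ → ℝ) (k : ℕ) :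
    ∑ i ∈ Finset.range (M ^ k), wordWeight M w k i = (∑ d ∈ Finset.range M, w d) ^ k := by
  induction k with
  | zero => simp [wordWeight]
  | succ k ih =>
    rw [pow_succ (∑ d ∈ Finset.range M, w d), ← ih, Finset.sum_mul_sum, ← Finset.sum_product']
    refine (Finset.sum_bij' (fun p _ => p.1 * M + p.2) (fun i _ => (i / M, i % M)) ?_ ?_ ?_ ?_ ?_).symm
    · rintro ⟨a, b⟩ h
      simp only [Finset.mem_product, Finset.mem_range] at h ⊢
      calc a * M + b < a * M + M := by omega
        _ = (a + 1) * M := by ring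
        _ ≤ M ^ k * M := Nat.mul_le_mul_right _ h.1
        _ = _ := (pow_succ _ _).symm
    · intro i hi
      simp only [Finset.mem_product, Finset.mem_range] at hi ⊢
      exact ⟨Nat.div_lt_of_lt_mul (by rwa [pow_succ'] at hi), Nat.mod_lt _ hM⟩
    · rintro ⟨a, b⟩ h
      simp only [Finset.mem_product, Finset.mem_range] at h
      rw [mul_comm a M, Nat.mul_add_div hM, Nat.mul_add_mod, Nat.div_eq_of_lt h.2,
        Nat.mod_eq_of_lt h.2, add_zero]
    · intro i _
      exact Nat.div_add_mod' i M
    · rintro ⟨a, b⟩ h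
      simp only [Finset.mem_product, Finset.mem_range] at h
      rw [wordWeight, mul_comm a M, Nat.mul_add_div hM, Nat.mul_add_mod, Nat.div_eq_of_lt h.2,
        Nat.mod_eq_of_lt h.2, add_zero]

theorem floor_pow_succ_mul {M : ℕ} (hM : 0 < M) (k : ℕ) {x : I} (hx : x ≠ 1) :
    ⌊(M : ℝ) ^ (k + 1) * x⌋₊ / M = ⌊(M : ℝ) ^ k * x⌋₊ ∧
      ⌊(M : ℝ) ^ (k + 1) * x⌋₊ % M = digit M ((timesMap M)^[k] x) := by
  have hM' : (0 : ℝ) < M := by exact_mod_cast hM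
  set y : ℝ := (M : ℝ) ^ k * x with hy
  have hy0 : 0 ≤ y := mul_nonneg (by positivity) x.2.1
  have h1 : (M : ℝ) ^ (k + 1) * x = ((M * ⌊y⌋₊ : ℕ) : ℝ) + M * Int.fract y := by
    have : (y : ℝ) = ⌊y⌋₊ + Int.fract y := by
      rw [natCast_floor_eq_intCast_floor hy0, Int.floor_add_fract]
    rw [pow_succ', mul_assoc, ← hy]
    push_cast
    linear_combination (M : ℝ) * this
  have h2 : ⌊(M : ℝ) * Int.fract y⌋₊ < M := by
    rw [Nat.floor_lt (by have := Int.fract_nonneg y; positivity)]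
    have := Int.fract_lt_one y
    nlinarith
  have h3 : ⌊(M : ℝ) ^ (k + 1) * x⌋₊ = M * ⌊y⌋₊ + ⌊(M : ℝ) * Int.fract y⌋₊ := by
    rw [h1, add_comm, Nat.floor_add_natCast (by have := Int.fract_nonneg y; positivity), add_comm]
  rw [h3, digit, coe_timesMap_iterate M k hx, Nat.mul_add_div hM, Nat.mul_add_mod,
    Nat.div_eq_of_lt h2, Nat.mod_eq_of_lt h2, add_zero]
  exact ⟨rfl, rfl⟩

/-- The Birkhoff sum depends only on the first k digits, so bounds on it become bounds on numbers of
words. -/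
theorem exp_birkhoffSum_log_digit {M : ℕ} (hM : 0 < M) {w : ℕ → ℝ} (hw : ∀ d, 0 < w d) (k : ℕ)
    {x : I} (hx : x ≠ 1) :
    Real.exp (birkhoffSum (timesMap M) (fun y => Real.log (w (digit M y))) k x) =
      wordWeight M w k ⌊(M : ℝ) ^ k * x⌋₊ := by
  induction k with
  | zero => simp [wordWeight]
  | succ k ih =>
    rw [birkhoffSum_succ, Real.exp_add, ih, Real.exp_log (hw _), wordWeight,
      (floor_pow_succ_mul hM k hx).1, (floor_pow_succ_mul hM k hx).2]

theorem measure_singleton_one {N : ℕ} {m : Measure I} (h : MeasurePreserving (timesMap N) m m) :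
    m {1} = 0 := by
  rw [← h.measure_preimage (measurableSet_singleton 1).nullMeasurableSet]
  convert measure_empty (μ := m)
  ext x
  simp only [mem_preimage, mem_singleton_iff, mem_empty_iff_false, iff_false]
  intro hx
  exact (Int.fract_lt_one ((N : ℝ) * x)).ne (congrArg Subtype.val hx)

theorem digit_lt {M : ℕ} (hM : 0 < M) {x : I} (hx : x ≠ 1) : digit M x < M := by
  have hM' : (0 : ℝ) < M := by exact_mod_cast hM
  rw [digit, Nat.floor_lt (mul_nonneg hM'.le x.2.1)]
  have := lt_one_of_ne hx
  nlinarith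

theorem sum_measureReal_digit {M : ℕ} (hM : 0 < M) {m : Measure I} [IsProbabilityMeasure m]
    (h1 : m {1} = 0) : ∑ d ∈ Finset.range M, m.real (digit M ⁻¹' {d}) = 1 := by
  rw [sum_measureReal_preimage_singleton _
    fun d _ => measurable_digit M (measurableSet_singleton d)]
  have : digit M ⁻¹' (Finset.range M : Set ℕ) =ᵐ[m] univ := by
    rw [eventuallyEq_univ]
    filter_upwards [compl_mem_ae_iff.2 h1] with x hx
    simpa using digit_lt hM hx
  rw [measureReal_congr this, probReal_univ]

end Digits

/-! ### Large Birkhoff sums infinitely often, on a set of positive measure. -/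

section Limsup

variable {α : Type*} [MeasurableSpace α] {m : Measure α} [IsFiniteMeasure m]

theorem measure_frequently_pos {E : ℕ → Set α} (hE : ∀ k, MeasurableSet (E k)) {δ : ℝ≥0∞}
    (hδ : 0 < δ) (h : ∃ᶠ k in atTop, δ ≤ m (E k)) : 0 < m {x | ∃ᶠ k in atTop, x ∈ E k} := by
  have h1 : {x | ∃ᶠ k in atTop, x ∈ E k} = ⋂ n, ⋃ k ∈ Ici n, E k := by
    ext x
    simp [frequently_atTop]
  rw [h1]
  have hanti : Antitone fun n => ⋃ k ∈ Ici n, E k := fun a b hab =>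
    biUnion_subset_biUnion_left (Ici_subset_Ici.2 hab)
  refine hδ.trans_le (ge_of_tendsto' (tendsto_measure_iInter_atTop
    (fun n => (MeasurableSet.biUnion (to_countable _) fun k _ => hE k).nullMeasurableSet) hanti
    ⟨0, measure_ne_top _ _⟩) fun n => ?_)
  obtain ⟨k, hk, hkδ⟩ := frequently_atTop.1 h n
  exact hkδ.trans (measure_mono (subset_biUnion_of_mem (u := fun k => E k) hk))

/-- Takes the place of the pointwise ergodic theorem: by invariance the mean of each Birkhoff sum is
k∫f, so the events have measure bounded below and their limsup is not null. -/
theorem frequently_birkhoffSum_pos {T : α → α} (hT : MeasurePreserving T m m) {f : α → ℝ}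
    (hf : Measurable f) {B : ℝ} (hB : ∀ x, |f x| ≤ B) {a : ℝ} (ha0 : 0 ≤ a)
    (ha : a * m.real univ < ∫ x, f x ∂m) :
    0 < m {x | ∃ᶠ k in atTop, k * a ≤ birkhoffSum T f k x} := by
  set c := ∫ x, f x ∂m
  have hc : 0 < c := lt_of_le_of_lt (mul_nonneg ha0 measureReal_nonneg) ha
  have hfi : Integrable f m := Integrable.of_bound hf.aestronglyMeasurable B
    (Eventually.of_forall hB)
  have hSm : ∀ k, Measurable (birkhoffSum T f k) := fun k => by
    unfold birkhoffSum
    exact Finset.measurable_sum _ fun j _ => hf.comp (hT.measurable.iterate j)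
  have hcomp : ∀ j, Integrable (fun x => f (T^[j] x)) m := fun j =>
    (hT.iterate j).integrable_comp_of_integrable hfi
  have hint : ∀ k, Integrable (birkhoffSum T f k) m := fun k =>
    integrable_finsetSum _ fun j _ => hcomp j
  have hSint : ∀ k : ℕ, ∫ x, birkhoffSum T f k x ∂m = k * c := fun k => by
    unfold birkhoffSum
    rw [integral_finsetSum _ fun j _ => hcomp j, Finset.sum_congr rfl fun j _ => ?_]
    · rw [Finset.sum_const, Finset.card_range, nsmul_eq_mul]
    · have := (hT.iterate j)
      rw [← integral_map this.aemeasurable (f := f) hf.aestronglyMeasurable, this.map_eq]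
  let E : ℕ → Set α := fun k => {x | k * a ≤ birkhoffSum T f k x}
  have hEm : ∀ k, MeasurableSet (E k) := fun k => measurableSet_le measurable_const (hSm k)
  have hB0 : 0 < B := by
    by_contra! hB0
    have : c ≤ 0 := integral_nonpos fun x => (le_abs_self _).trans ((hB x).trans hB0)
    linarith
  -- Obtained by integrating S_k ≤ ka + kB·1_{E_k}, which gives c ≤ a·m(univ) + B·m(E_k).
  set δ := (c - a * m.real univ) / B
  have hδ : 0 < δ := div_pos (by linarith) hB0
  refine measure_frequently_pos hEm (ENNReal.ofReal_pos.2 hδ)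
    ((eventually_gt_atTop 0).mono fun k hk => ?_).frequently
  have hk' : (0 : ℝ) < k := by exact_mod_cast hk
  refine (ENNReal.ofReal_le_iff_le_toReal (measure_ne_top m (E k))).2 ?_
  change δ ≤ m.real (E k)
  have hpt : ∀ x, birkhoffSum T f k x ≤ k * a + (E k).indicator (fun _ => k * B) x := fun x => by
    by_cases hx : x ∈ E k
    · rw [indicator_of_mem hx]
      have : birkhoffSum T f k x ≤ k * B := by
        unfold birkhoffSum
        calc ∑ j ∈ Finset.range k, f (T^[j] x) ≤ ∑ j ∈ Finset.range k, B :=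
              Finset.sum_le_sum fun j _ => (le_abs_self _).trans (hB _)
          _ = k * B := by simp
      nlinarith
    · rw [indicator_of_notMem hx]
      have : ¬ (k * a ≤ birkhoffSum T f k x) := hx
      linarith
  have h1 := integral_mono (hint k)
    ((integrable_const _).add ((integrable_const (k * B)).indicator (hEm k))) hpt
  rw [hSint, integral_add' (integrable_const _) ((integrable_const (k * B)).indicator (hEm k)),
    integral_const, integral_indicator_const _ (hEm k), smul_eq_mul, smul_eq_mul] at h1
  have h2 : k * (c - a * m.real univ) ≤ k * (B * m.real (E k)) := by linarith
  rw [div_le_iff₀ hB0, mul_comm _ B]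
  exact le_of_mul_le_mul_left h2 hk'

end Limsup

/-! ### Lebesgue measure as the only invariant measure of full dimension. -/

theorem ediam_cylinder_le {K : ℝ} (hK : 0 < K) (i : ℕ) :
    Metric.ediam {x : I | ⌊K * (x : ℝ)⌋₊ = i} ≤ ENNReal.ofReal K⁻¹ := by
  refine Metric.ediam_le fun x hx y hy => ?_
  rw [edist_dist]
  refine ENNReal.ofReal_le_ofReal ?_
  have hx' : ⌊K * (x : ℝ)⌋₊ = i := hx
  have hy' : ⌊K * (y : ℝ)⌋₊ = i := hy
  rw [Nat.floor_eq_iff (mul_nonneg hK.le x.2.1)] at hx'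
  rw [Nat.floor_eq_iff (mul_nonneg hK.le y.2.1)] at hy'
  rw [Subtype.dist_eq, Real.dist_eq, abs_le, inv_eq_one_div, ← neg_div]
  constructor
  · rw [div_le_iff₀ hK]; linarith
  · rw [le_div_iff₀ hK]; linarith

theorem exists_rpow_mul_exp_neg_lt_one {M : ℝ} (hM : 1 < M) {a : ℝ} (ha : 0 < a) :
    ∃ s : NNReal, 0 < s ∧ s < 1 ∧ M ^ (1 - (s : ℝ)) * Real.exp (-a) < 1 := by
  have hlog : 0 < Real.log M := Real.log_pos hM
  -- With s = 1 - η, the bound 1/2 keeps s positive and the other bound gives M^η e^(-a) ≤ e^(-a/2).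
  set η : ℝ := min (1 / 2) (a / (2 * Real.log M))
  have hη0 : 0 < η := by positivity
  have hη1 : η ≤ 1 / 2 := min_le_left _ _
  have hη2 : η * (2 * Real.log M) ≤ a := by
    rw [← le_div_iff₀ (by positivity)]
    exact min_le_right _ _
  obtain ⟨s, hs⟩ : ∃ s : NNReal, (s : ℝ) = 1 - η :=
    ⟨(1 - η).toNNReal, Real.coe_toNNReal _ (by linarith)⟩
  refine ⟨s, ?_, ?_, ?_⟩
  · rw [← NNReal.coe_pos]; linarith
  · rw [← NNReal.coe_lt_coe, NNReal.coe_one]; linarith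
  · rw [hs, sub_sub_cancel, Real.rpow_def_of_pos (by linarith), ← Real.exp_add, Real.exp_lt_one_iff]
    nlinarith

/-- The set of points whose orbit average of `log w` is infinitely often at least `a > 0` has
dimension less than one, when the weights `w` of the digits have mean one. -/
theorem dimH_frequently_birkhoffSum_lt_one {M : ℕ} (hM : 2 ≤ M) {w : ℕ → ℝ} (hw : ∀ d, 0 < w d)
    (hsum : ∑ d ∈ Finset.range M, w d = M) {a : ℝ} (ha : 0 < a) :
    dimH {x : I | x ≠ 1 ∧ ∃ᶠ k : ℕ in atTop,
      k * a ≤ birkhoffSum (timesMap M) (fun y => Real.log (w (digit M y))) k x} < 1 := by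
  have hM0 : 0 < M := by omega
  have hM1 : (1 : ℝ) < M := by exact_mod_cast hM
  have hM0' : (0 : ℝ) < M := by linarith
  obtain ⟨s, hs0, hs1, hs⟩ := exists_rpow_mul_exp_neg_lt_one hM1 ha
  have hs0' : (0 : ℝ) < s := hs0
  let good : ℕ → Finset ℕ := fun k =>
    (Finset.range (M ^ k)).filter fun i => Real.exp (k * a) ≤ wordWeight M w k i
  let U : ℕ → ℕ → Set I := fun k i => if i ∈ good k then {x | ⌊(M : ℝ) ^ k * x⌋₊ = i} else ∅
  -- Markov's inequality: all words of length k have total weight M^k, and each good one weighs at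
  -- least e^(ka).
  have hcard : ∀ k, ((good k).card : ℝ) ≤ (M * Real.exp (-a)) ^ k := fun k => by
    have h1 : (good k).card * Real.exp (k * a) ≤ (M : ℝ) ^ k := by
      rw [← hsum, ← sum_wordWeight hM0, ← nsmul_eq_mul]
      calc _ ≤ ∑ i ∈ good k, wordWeight M w k i :=
            Finset.card_nsmul_le_sum _ _ _ fun i hi => (Finset.mem_filter.1 hi).2
        _ ≤ _ := Finset.sum_le_sum_of_subset_of_nonneg (Finset.filter_subset _ _)
            fun i _ _ => wordWeight_nonneg (fun d => (hw d).le) k i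
    rw [mul_pow, ← Real.exp_nat_mul, mul_neg, Real.exp_neg, ← div_eq_mul_inv,
      le_div_iff₀ (Real.exp_pos _)]
    exact h1
  set ρ : ℝ := (M : ℝ) ^ (1 - (s : ℝ)) * Real.exp (-a)
  have hρ0 : 0 ≤ ρ := by positivity
  have hlevel : ∀ k, ∑' i, Metric.ediam (U k i) ^ (s : ℝ) ≤ ENNReal.ofReal ρ ^ k := fun k => by
    rw [tsum_eq_sum (s := good k) fun i hi => by
      simp [U, hi, ENNReal.zero_rpow_of_pos hs0']]
    have hterm : ∀ i ∈ good k, Metric.ediam (U k i) ^ (s : ℝ) ≤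
        ENNReal.ofReal (((M : ℝ) ^ (-(s : ℝ))) ^ k) := fun i hi => by
      simp only [U, if_pos hi]
      refine (ENNReal.rpow_le_rpow (ediam_cylinder_le (by positivity) i) hs0'.le).trans_eq ?_
      rw [ENNReal.ofReal_rpow_of_pos (by positivity)]
      congr 1
      rw [Real.rpow_neg hM0'.le, inv_pow, Real.inv_rpow (by positivity), ← Real.rpow_natCast,
        ← Real.rpow_natCast, ← Real.rpow_mul hM0'.le, ← Real.rpow_mul hM0'.le, mul_comm]
    refine (Finset.sum_le_card_nsmul _ _ _ hterm).trans ?_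
    rw [nsmul_eq_mul, ← ENNReal.ofReal_natCast, ← ENNReal.ofReal_mul (by positivity),
      ← ENNReal.ofReal_pow hρ0]
    refine ENNReal.ofReal_le_ofReal ?_
    calc _ ≤ (M * Real.exp (-a)) ^ k * ((M : ℝ) ^ (-(s : ℝ))) ^ k := by
          gcongr
          exact hcard k
      _ = ρ ^ k := by
        rw [← mul_pow]
        congr 1
        simp only [ρ]
        rw [sub_eq_add_neg, Real.rpow_add hM0', Real.rpow_one]
        ring
  refine lt_of_le_of_lt (dimH_le_of_frequently_mem_cover hs0 U ?_ ?_) (by exact_mod_cast hs1)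
  · refine ne_of_lt (lt_of_le_of_lt (ENNReal.tsum_le_tsum hlevel) ?_)
    rw [ENNReal.tsum_geometric, ENNReal.inv_lt_top, tsub_pos_iff_lt]
    exact ENNReal.ofReal_lt_one.2 hs
  · rintro x ⟨hx1, hx⟩
    refine hx.mono fun k hk => ⟨⌊(M : ℝ) ^ k * x⌋₊, ?_⟩
    have hmem : ⌊(M : ℝ) ^ k * x⌋₊ ∈ good k := by
      refine Finset.mem_filter.2 ⟨?_, ?_⟩
      · rw [Finset.mem_range, Nat.floor_lt (mul_nonneg (by positivity) x.2.1)]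
        have := lt_one_of_ne hx1
        push_cast
        have h2 : (0 : ℝ) < (M : ℝ) ^ k := by positivity
        nlinarith
      · rw [← exp_birkhoffSum_log_digit hM0 hw k hx1]
        exact Real.exp_le_exp.2 hk
    simp [U, hmem]

/-- A Gibbs-type inequality: the mean of `log ((M p + 1) / 2)` under `p` is positive unless `p` is
uniform. -/
theorem sum_mul_log_pos {M : ℕ} (hM : 0 < M) {p : ℕ → ℝ} (hp : ∀ d, 0 ≤ p d)
    (hsum : ∑ d ∈ Finset.range M, p d = 1) (hne : ∃ d ∈ Finset.range M, p d ≠ 1 / M) :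
    0 < ∑ d ∈ Finset.range M, p d * Real.log ((M * p d + 1) / 2) := by
  have hM' : (0 : ℝ) < M := by exact_mod_cast hM
  -- This is log x ≥ 1 - 1/x, split into a linear term with sum zero and a square that vanishes only
  -- at p d = 1/M.
  have hpt : ∀ d, (p d - 1 / M) / 2 + (M * p d - 1) ^ 2 / (2 * M * (M * p d + 1)) ≤
      p d * Real.log ((M * p d + 1) / 2) := fun d => by
    have hd := hp d
    have h1 : 0 < M * p d + 1 := by positivity
    have h2 := Real.one_sub_inv_le_log_of_pos (x := (M * p d + 1) / 2) (by positivity)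
    refine le_trans (le_of_eq ?_) (mul_le_mul_of_nonneg_left h2 hd)
    field_simp
    ring
  have h0 : ∑ d ∈ Finset.range M, (p d - 1 / M) / 2 = 0 := by
    rw [← Finset.sum_div, Finset.sum_sub_distrib, hsum]
    simp [hM'.ne']
  have hpos : 0 < ∑ d ∈ Finset.range M, (M * p d - 1) ^ 2 / (2 * M * (M * p d + 1)) := by
    obtain ⟨d, hd, hne⟩ := hne
    refine Finset.sum_pos' (fun d _ => by have := hp d; positivity) ⟨d, hd, ?_⟩
    have h1 : M * p d - 1 ≠ 0 := fun h => hne (by field_simp; linarith)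
    have := hp d
    positivity
  calc 0 < _ := hpos
    _ = ∑ d ∈ Finset.range M,
        ((p d - 1 / M) / 2 + (M * p d - 1) ^ 2 / (2 * M * (M * p d + 1))) := by
      rw [Finset.sum_add_distrib, h0, zero_add]
    _ ≤ _ := Finset.sum_le_sum fun d _ => hpt d

theorem exists_dimH_lt_one_of_digit {M : ℕ} (hM : 2 ≤ M) {m : Measure I} [IsProbabilityMeasure m]
    (h : MeasurePreserving (timesMap M) m m)
    (hne : ∃ d ∈ Finset.range M, m.real (digit M ⁻¹' {d}) ≠ 1 / M) :
    ∃ A : Set I, 0 < m A ∧ MeasurableSet A ∧ dimH A < 1 := by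
  have hM0 : 0 < M := by omega
  have hM0' : (0 : ℝ) < M := by exact_mod_cast hM0
  have h1 := measure_singleton_one h
  let p : ℕ → ℝ := fun d => m.real (digit M ⁻¹' {d})
  have hp0 : ∀ d, 0 ≤ p d := fun d => measureReal_nonneg
  have hp1 : ∀ d, p d ≤ 1 := fun d => measureReal_le_one
  have hpsum : ∑ d ∈ Finset.range M, p d = 1 := sum_measureReal_digit hM0 h1
  -- Averaging M·p with 1 keeps w ≥ 1/2, so `log w` stays bounded even when some digit has
  -- probability 0.
  let w : ℕ → ℝ := fun d => (M * p d + 1) / 2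
  have hw : ∀ d, 0 < w d := fun d => by have := hp0 d; simp only [w]; positivity
  have hwsum : ∑ d ∈ Finset.range M, w d = M := by
    simp only [w]
    rw [← Finset.sum_div, Finset.sum_add_distrib, ← Finset.mul_sum, hpsum]
    simp
  let f : I → ℝ := fun y => Real.log (w (digit M y))
  have hf : Measurable f := (measurable_from_nat (f := fun d => Real.log (w d))).comp
    (measurable_digit M)
  have hB : ∀ x, |f x| ≤ max (-Real.log (1 / 2)) (Real.log ((M + 1) / 2)) := fun x => by
    have h0 := hp0 (digit M x)
    have h2 := hp1 (digit M x)
    have h3 : Real.log (1 / 2) ≤ f x := Real.log_le_log (by norm_num) (by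
      simp only [w]; nlinarith)
    have h4 : f x ≤ Real.log ((M + 1) / 2) := Real.log_le_log (hw _) (by
      simp only [w]; nlinarith)
    exact abs_le'.2 ⟨h4.trans (le_max_right _ _), (neg_le_neg h3).trans (le_max_left _ _)⟩
  have hint : ∫ x, f x ∂m = ∑ d ∈ Finset.range M, p d * Real.log (w d) := by
    have hms : ∀ d, MeasurableSet (digit M ⁻¹' {d}) := fun d =>
      measurable_digit M (measurableSet_singleton d)
    have hae : f =ᵐ[m] fun x => ∑ d ∈ Finset.range M,
        (digit M ⁻¹' {d}).indicator (fun _ => Real.log (w d)) x := by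
      filter_upwards [compl_mem_ae_iff.2 h1] with x hx
      rw [Finset.sum_eq_single (digit M x)]
      · simp [f]
      · intro d _ hd
        exact indicator_of_notMem (fun h => hd h.symm) _
      · exact fun h => absurd (Finset.mem_range.2 (digit_lt hM0 hx)) h
    rw [integral_congr_ae hae, integral_finsetSum _ fun d _ =>
      (integrable_const _).indicator (hms d)]
    exact Finset.sum_congr rfl fun d _ => by rw [integral_indicator_const _ (hms d), smul_eq_mul]
  have hc : 0 < ∫ x, f x ∂m := hint ▸ sum_mul_log_pos hM0 hp0 hpsum hne
  have hpos := frequently_birkhoffSum_pos h hf hB (a := (∫ x, f x ∂m) / 2) (half_pos hc).le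
    (by rw [probReal_univ]; linarith)
  set A := {x : I | ∃ᶠ k : ℕ in atTop,
    k * ((∫ x, f x ∂m) / 2) ≤ birkhoffSum (timesMap M) f k x}
  have hSm : ∀ k, Measurable (birkhoffSum (timesMap M) f k) := fun k => by
    unfold birkhoffSum
    exact Finset.measurable_sum _ fun j _ => hf.comp (h.measurable.iterate j)
  have hAm : MeasurableSet A := by
    have : A = ⋂ n : ℕ, ⋃ k ∈ Ici n, {x | k * ((∫ x, f x ∂m) / 2) ≤
        birkhoffSum (timesMap M) f k x} := by
      ext x
      simp [A, frequently_atTop]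
    rw [this]
    exact MeasurableSet.iInter fun n => MeasurableSet.biUnion (to_countable _) fun k _ =>
      measurableSet_le measurable_const (hSm k)
  refine ⟨{1}ᶜ ∩ A, ?_, (measurableSet_singleton 1).compl.inter hAm,
    dimH_frequently_birkhoffSum_lt_one hM hw hwsum (half_pos hc)⟩
  rwa [inter_comm, ← sdiff_eq, measure_sdiff_null h1]

/-- Uniform digits in base N^(n+1) determine the distribution function up to N^(-(n+1)). -/
theorem eq_volume_of_digit {N : ℕ} (hN : 2 ≤ N) {m : Measure I} [IsProbabilityMeasure m]
    (h : ∀ n, ∀ d ∈ Finset.range (N ^ (n + 1)),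
      m.real (digit (N ^ (n + 1)) ⁻¹' {d}) = 1 / (N ^ (n + 1) : ℕ)) : m = volume := by
  refine Measure.ext_of_Iic _ _ fun a => ?_
  rw [unitInterval.volume_Iic, ← ofReal_measureReal]
  congr 1
  have hcyl : ∀ n, ∀ k ≤ N ^ (n + 1),
      m.real (digit (N ^ (n + 1)) ⁻¹' (Finset.range k : Set ℕ)) = k / (N ^ (n + 1) : ℕ) := by
    intro n k hk
    rw [← sum_measureReal_preimage_singleton _
      fun d _ => measurable_digit _ (measurableSet_singleton d), Finset.sum_congr rfl fun d hd =>
      h n d (Finset.range_subset_range.2 hk hd)]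
    simp [div_eq_mul_inv]
  have hbound : ∀ n, |m.real (Iic a) - a| ≤ 1 / (N : ℝ) ^ (n + 1) := by
    intro n
    set M := N ^ (n + 1) with hMdef
    have hM0 : 0 < M := by positivity
    have hM0' : (0 : ℝ) < M := by exact_mod_cast hM0
    have hMc : (N : ℝ) ^ (n + 1) = M := by rw [hMdef]; push_cast; rfl
    set k := digit M a with hk
    have hka : (k : ℝ) ≤ M * a := Nat.floor_le (mul_nonneg hM0'.le a.2.1)
    have hak : M * (a : ℝ) < k + 1 := Nat.lt_floor_add_one _
    have ha1 : (a : ℝ) ≤ 1 := a.2.2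
    have hkM : k ≤ M := by
      have : (k : ℝ) ≤ M := by nlinarith
      exact_mod_cast this
    have hlow : (k : ℝ) / M ≤ m.real (Iic a) := by
      rw [← hcyl n k hkM]
      refine measureReal_mono fun x hx => ?_
      have hx' : digit M x < digit M a := by simpa using hx
      by_contra hxa
      refine absurd hx' (not_lt.2 (Nat.floor_le_floor ?_))
      have : (a : ℝ) ≤ x := (not_le.1 hxa).le
      gcongr
    -- The case k = M occurs only at a = 1, where the bound is trivial.
    have hup : m.real (Iic a) ≤ (k + 1) / M := by
      rcases hkM.lt_or_eq with hlt | heq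
      · have := hcyl n (k + 1) hlt
        push_cast at this
        rw [hMdef] at hMc
        rw [hMdef]
        push_cast
        rw [← this]
        refine measureReal_mono fun x hx => ?_
        have hx' : (x : ℝ) ≤ a := hx
        have : digit M x ≤ digit M a := Nat.floor_le_floor (by gcongr)
        simpa [Nat.lt_succ_iff] using this
      · rw [heq]
        refine measureReal_le_one.trans ?_
        rw [le_div_iff₀ hM0']
        linarith
    rw [hMc, abs_le]
    have h1 : (a : ℝ) < k / M + 1 / M := by
      rw [← add_div, lt_div_iff₀ hM0']; linarith
    have h2 : (k : ℝ) / M ≤ a := by rw [div_le_iff₀ hM0']; linarith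
    rw [add_div] at hup
    constructor <;> linarith
  have hlim : Tendsto (fun n : ℕ => 1 / (N : ℝ) ^ (n + 1)) atTop (𝓝 0) := by
    have hN1 : (1 : ℝ) < N := by exact_mod_cast hN
    simp_rw [one_div]
    exact tendsto_inv_atTop_zero.comp
      ((tendsto_pow_atTop_atTop_of_one_lt hN1).comp (tendsto_add_atTop_nat 1))
  have := ge_of_tendsto' hlim hbound
  exact sub_eq_zero.1 (abs_nonpos_iff.1 this)

/-- Lebesgue measure is the only invariant probability measure of full dimension. -/
theorem exists_dimH_lt_one_of_ne_volume {N : ℕ} (hN : 2 ≤ N) {m : Measure I}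
    [IsProbabilityMeasure m] (h : MeasurePreserving (timesMap N) m m) (hne : m ≠ volume) :
    ∃ A : Set I, 0 < m A ∧ MeasurableSet A ∧ dimH A < 1 := by
  by_contra hA
  refine hne (eq_volume_of_digit hN fun n d hd => ?_)
  by_contra hd'
  have hM : 2 ≤ N ^ (n + 1) := hN.trans (Nat.le_self_pow n.succ_ne_zero N)
  exact hA (exists_dimH_lt_one_of_digit hM (timesMap_iterate_succ N n ▸ h.iterate (n + 1))
    ⟨d, hd, hd'⟩)

/-! ### Ergodic marginals, and integer projections modulo one. -/

section Circle

theorem dimH_fract_preimage_le {c : ℝ} (hc : c ≠ 0) (A : Set I) :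
    dimH {t : ℝ | ∃ a ∈ A, Int.fract (c * t) = a} ≤ dimH A := by
  have hsub : {t : ℝ | ∃ a ∈ A, Int.fract (c * t) = a} ⊆
      ⋃ z : ℤ, (fun y : I => c⁻¹ * ((y : ℝ) + z)) '' A := by
    rintro t ⟨a, ha, hat⟩
    refine mem_iUnion.2 ⟨⌊c * t⌋, a, ha, ?_⟩
    simp only
    rw [← hat, Int.fract_add_floor, inv_mul_cancel_left₀ hc]
  refine (dimH_mono hsub).trans ?_
  rw [dimH_iUnion]
  refine iSup_le fun z => LipschitzWith.dimH_image_le (K := ‖c⁻¹‖₊) ?_ A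
  refine LipschitzWith.of_dist_le_mul fun x y => le_of_eq ?_
  rw [Real.dist_eq, ← mul_sub, abs_mul, Subtype.dist_eq, Real.dist_eq, add_sub_add_right_eq_sub]
  simp

theorem dimH_timesMap_preimage_le {N : ℕ} (hN : N ≠ 0) (A : Set I) :
    dimH (timesMap N ⁻¹' A) ≤ dimH A := by
  rw [← isometry_subtype_coe.dimH_image]
  refine (dimH_mono ?_).trans (dimH_fract_preimage_le (Nat.cast_ne_zero.2 hN) A)
  rintro _ ⟨x, hx, rfl⟩
  exact ⟨_, hx, rfl⟩

/-- The union of all preimages of a charged set of dimension below one has full measure by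
ergodicity. Preimages do not raise dimension, so the union is Lebesgue-null. -/
theorem exists_full_volume_null {N : ℕ} (hN : 2 ≤ N) {m : Measure I} [IsProbabilityMeasure m]
    (h : Ergodic (timesMap N) m) (hne : m ≠ volume) :
    ∃ B : Set I, MeasurableSet B ∧ m Bᶜ = 0 ∧ volume B = 0 := by
  obtain ⟨A, hA, hAm, hAd⟩ := exists_dimH_lt_one_of_ne_volume hN h.toMeasurePreserving hne
  have hBm : MeasurableSet (⋃ n, (timesMap N)^[n] ⁻¹' A) :=
    MeasurableSet.iUnion fun n => (h.measurable.iterate n) hAm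
  refine ⟨⋃ n, (timesMap N)^[n] ⁻¹' A, hBm, ?_, volume_eq_zero_of_dimH_lt_one ?_⟩
  · have hsub : timesMap N ⁻¹' (⋃ n, (timesMap N)^[n] ⁻¹' A) ⊆ ⋃ n, (timesMap N)^[n] ⁻¹' A := by
      intro x hx
      obtain ⟨n, hn⟩ := mem_iUnion.1 hx
      exact mem_iUnion.2 ⟨n + 1, hn⟩
    rcases h.ae_empty_or_univ_of_preimage_ae_le hBm.nullMeasurableSet
      (Eventually.of_forall hsub) with h0 | h0
    · refine absurd (measure_mono_null (subset_iUnion _ 0) (ae_eq_empty.1 h0)) ?_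
      simpa using hA.ne'
    · exact ae_eq_univ.1 h0
  · rw [dimH_iUnion]
    refine lt_of_le_of_lt (iSup_le fun n => ?_) hAd
    induction n with
    | zero => simp
    | succ n ih =>
      rw [Function.iterate_succ, preimage_comp]
      exact (dimH_timesMap_preimage_le (by omega) _).trans ih

/-- The map `x ↦ p x₁ + q x₂ mod 1`. -/
noncomputable def combMod (p q : ℤ) (x : I × I) : I :=
  ⟨Int.fract ((p : ℝ) * x.1 + q * x.2), Int.fract_nonneg _, (Int.fract_lt_one _).le⟩

theorem measurable_combMod (p q : ℤ) : Measurable (combMod p q) :=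
  (measurable_fract.comp (by fun_prop)).subtype_mk

theorem combMod_semiconj (N : ℕ) (p q : ℤ) :
    Function.Semiconj (combMod p q) (timesMap₂ N) (timesMap N) := by
  intro x
  ext
  simp only [combMod, timesMap₂, timesMap]
  rw [fract_natCast_mul_fract, Int.fract_eq_fract]
  refine ⟨-(p * ⌊(N : ℝ) * x.1⌋ + q * ⌊(N : ℝ) * x.2⌋), ?_⟩
  push_cast
  rw [Int.fract, Int.fract]
  ring

theorem map_combMod_eq_volume {N : ℕ} (hN : 2 ≤ N) {μ : Measure (I × I)} [IsProbabilityMeasure μ]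
    (hμ : MeasurePreserving (timesMap₂ N) μ μ) {p q : ℤ}
    (h : 1 ≤ measureDimH (μ.map (proj ((p : ℝ), (q : ℝ))))) :
    μ.map (combMod p q) = volume := by
  have hm := measurable_combMod p q
  have : IsProbabilityMeasure (μ.map (combMod p q)) :=
    Measure.isProbabilityMeasure_map hm.aemeasurable
  by_contra hne
  obtain ⟨A, hA, hAm, hAd⟩ := exists_dimH_lt_one_of_ne_volume hN
    ((hm.measurePreserving μ).of_semiconj hμ (combMod_semiconj N p q) (measurable_timesMap N)) hne
  let φ : ℝ → I := fun t => ⟨Int.fract t, Int.fract_nonneg _, (Int.fract_lt_one _).le⟩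
  have hφ : Measurable φ := measurable_fract.subtype_mk
  have hcomp : combMod p q = φ ∘ proj ((p : ℝ), (q : ℝ)) := by
    funext x
    ext
    simp [combMod, φ, proj, mul_comm]
  have hpos : 0 < μ.map (proj ((p : ℝ), (q : ℝ))) (φ ⁻¹' A) := by
    rw [Measure.map_apply (measurable_proj _) (hφ hAm), ← preimage_comp, ← hcomp,
      ← Measure.map_apply hm hAm]
    exact hA
  have hle : dimH (φ ⁻¹' A) ≤ dimH A :=
    (dimH_mono (fun t (ht : φ t ∈ A) =>
      (⟨φ t, ht, by simp [φ]⟩ : ∃ a ∈ A, Int.fract (1 * t) = a))).trans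
      (dimH_fract_preimage_le one_ne_zero A)
  exact absurd (h.trans (iInf₂_le_of_le _ (hφ hAm) (iInf_le _ hpos))) (not_le.2 (hle.trans_lt hAd))

theorem integral_fourier_volume {h : ℤ} (hh : h ≠ 0) :
    ∫ x : I, fourier h ((x : ℝ) : UnitAddCircle) = 0 := by
  have h1 : ∫ x : I, fourier h ((x : ℝ) : UnitAddCircle) =
      ∫ x in I, fourier h ((x : ℝ) : UnitAddCircle) := by
    rw [← unitInterval.measurePreserving_coe.integral_comp unitInterval.measurableEmbedding_coe
      (fun x : ℝ => fourier h (x : UnitAddCircle))]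
  rw [h1, integral_Icc_eq_integral_Ioc, ← intervalIntegral.integral_of_le zero_le_one]
  have hc : (2 * Real.pi * Complex.I * h : ℂ) ≠ 0 := by
    simp [Real.pi_ne_zero, hh]
  simp_rw [fourier_coe_apply, Complex.ofReal_one, div_one]
  rw [integral_exp_mul_complex hc]
  have : Complex.exp (2 * Real.pi * Complex.I * h * (1 : ℝ)) = 1 := by
    rw [Complex.exp_eq_one_iff]
    exact ⟨h, by push_cast; ring⟩
  rw [this]
  simp

/-- The integrand is the first character evaluated at `combMod p q x`. -/
theorem integral_fourier_combMod {μ : Measure (I × I)} {p q : ℤ}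
    (h : μ.map (combMod p q) = volume) :
    ∫ x, fourier p ((x.1 : ℝ) : UnitAddCircle) * fourier q ((x.2 : ℝ) : UnitAddCircle) ∂μ = 0 := by
  have h1 := integral_fourier_volume one_ne_zero
  rw [← h, integral_map (measurable_combMod p q).aemeasurable (by
    refine Continuous.aestronglyMeasurable ?_
    exact (map_continuous _).comp ((AddCircle.continuous_mk' 1).comp continuous_subtype_val))] at h1
  rw [← h1]
  congr 1
  funext x
  have h2 : ((combMod p q x : ℝ) : UnitAddCircle) =
      p • ((x.1 : ℝ) : UnitAddCircle) + q • ((x.2 : ℝ) : UnitAddCircle) := by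
    rw [← AddCircle.coe_zsmul, ← AddCircle.coe_zsmul, ← AddCircle.coe_add, zsmul_eq_mul,
      zsmul_eq_mul]
    change ((Int.fract _ : ℝ) : UnitAddCircle) = _
    rw [Int.fract, AddCircle.coe_sub]
    have : ((⌊(p : ℝ) * x.1 + q * x.2⌋ : ℝ) : UnitAddCircle) = 0 := by
      rw [AddCircle.coe_eq_zero_iff]
      exact ⟨⌊(p : ℝ) * x.1 + q * x.2⌋, by simp⟩
    rw [this, sub_zero]
  rw [h2]
  simp [fourier_apply, AddCircle.toCircle_add]

end Circle

/-! ### Fourier uniqueness, moved from the torus to the square. -/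

section Torus

/-- Finite measures on the torus with the same Fourier coefficients are equal. -/
theorem ext_of_integral_mFourier {d : Type*} [Fintype d] {P P' : Measure (UnitAddTorus d)}
    [IsFiniteMeasure P] [IsFiniteMeasure P']
    (h : ∀ n : d → ℤ, ∫ x, UnitAddTorus.mFourier n x ∂P = ∫ x, UnitAddTorus.mFourier n x ∂P') :
    P = P' := by
  have hint : ∀ (Q : Measure (UnitAddTorus d)) [IsFiniteMeasure Q] (f : C(UnitAddTorus d, ℂ)),
      Integrable f Q := fun Q _ f =>
    (BoundedContinuousFunction.mkOfCompact f).integrable Q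
  -- Trigonometric polynomials form a star subalgebra separating points, so their integrals
  -- determine a finite measure; linearity reduces this to monomials.
  refine ext_of_forall_mem_subalgebra_integral_eq_of_pseudoEMetric_complete_countable (𝕜 := ℂ)
    (A := (UnitAddTorus.mFourierSubalgebra d).comap
      (BoundedContinuousFunction.toContinuousMapStarₐ ℂ)) ?_ ?_
  · intro x y hxy
    obtain ⟨_, ⟨f, hf, rfl⟩, hne⟩ := UnitAddTorus.mFourierSubalgebra_separatesPoints hxy
    exact ⟨_, ⟨f, ⟨BoundedContinuousFunction.mkOfCompact f, hf, by ext; rfl⟩, rfl⟩, hne⟩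
  · intro g hg
    have hg' : (g : C(UnitAddTorus d, ℂ)) ∈
        Submodule.span ℂ (range (UnitAddTorus.mFourier (d := d))) := by
      rw [← UnitAddTorus.mFourierSubalgebra_coe]
      exact hg
    change ∫ x, (g : C(UnitAddTorus d, ℂ)) x ∂P = ∫ x, (g : C(UnitAddTorus d, ℂ)) x ∂P'
    generalize (g : C(UnitAddTorus d, ℂ)) = g' at hg'
    induction hg' using Submodule.span_induction with
    | mem f hf => obtain ⟨n, rfl⟩ := hf; exact h n
    | zero => simp
    | add f f' _ _ hf hf' =>
      simp only [ContinuousMap.add_apply]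
      rw [integral_add (hint P f) (hint P f'), integral_add (hint P' f) (hint P' f'), hf, hf']
    | smul c f _ hf =>
      simp only [ContinuousMap.smul_apply]
      rw [integral_smul, integral_smul, hf]

/-- The projection of the unit square to the torus. -/
noncomputable def toTorus (x : I × I) : UnitAddTorus (Fin 2) :=
  ![((x.1 : ℝ) : UnitAddCircle), ((x.2 : ℝ) : UnitAddCircle)]

theorem continuous_toTorus : Continuous toTorus := by
  refine continuous_pi fun i => ?_
  fin_cases i
  · exact (AddCircle.continuous_mk' 1).comp (continuous_subtype_val.comp continuous_fst)
  · exact (AddCircle.continuous_mk' 1).comp (continuous_subtype_val.comp continuous_snd)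

/-- The representative in `[0,1)` of a point of the circle. -/
noncomputable def ofCircle (z : UnitAddCircle) : I :=
  ⟨AddCircle.measurableEquivIco 1 0 z, by
    have := (AddCircle.measurableEquivIco (1 : ℝ) 0 z).2
    exact ⟨this.1, this.2.le.trans_eq (zero_add 1)⟩⟩

theorem measurable_ofCircle : Measurable ofCircle :=
  (measurable_subtype_coe.comp (AddCircle.measurableEquivIco (1 : ℝ) 0).measurable).subtype_mk

theorem ofCircle_coe {x : I} (hx : x ≠ 1) : ofCircle ((x : ℝ) : UnitAddCircle) = x := by
  ext
  exact AddCircle.equivIco_coe_of_mem (p := (1 : ℝ)) (a := 0)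
    ⟨x.2.1, by simpa using lt_one_of_ne hx⟩

theorem map_ofCircle_map_toTorus {P : Measure (I × I)} (hP : ∀ᵐ x ∂P, x.1 ≠ 1 ∧ x.2 ≠ 1) :
    (P.map toTorus).map (fun z => (ofCircle (z 0), ofCircle (z 1))) = P := by
  have hm : Measurable fun z : UnitAddTorus (Fin 2) => (ofCircle (z 0), ofCircle (z 1)) :=
    (measurable_ofCircle.comp (measurable_pi_apply 0)).prodMk
      (measurable_ofCircle.comp (measurable_pi_apply 1))
  rw [Measure.map_map hm continuous_toTorus.measurable]
  refine Eq.trans (Measure.map_congr ?_) Measure.map_id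
  filter_upwards [hP] with x hx
  exact Prod.ext (ofCircle_coe hx.1) (ofCircle_coe hx.2)

theorem ext_of_integral_fourier {P P' : Measure (I × I)} [IsFiniteMeasure P] [IsFiniteMeasure P']
    (hP : ∀ᵐ x ∂P, x.1 ≠ 1 ∧ x.2 ≠ 1) (hP' : ∀ᵐ x ∂P', x.1 ≠ 1 ∧ x.2 ≠ 1)
    (h : ∀ p q : ℤ,
      ∫ x, fourier p ((x.1 : ℝ) : UnitAddCircle) * fourier q ((x.2 : ℝ) : UnitAddCircle) ∂P =
      ∫ x, fourier p ((x.1 : ℝ) : UnitAddCircle) * fourier q ((x.2 : ℝ) : UnitAddCircle) ∂P') :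
    P = P' := by
  rw [← map_ofCircle_map_toTorus hP, ← map_ofCircle_map_toTorus hP']
  congr 1
  refine ext_of_integral_mFourier fun n => ?_
  have hmap : ∀ Q : Measure (I × I), ∫ z, UnitAddTorus.mFourier n z ∂(Q.map toTorus) =
      ∫ x, fourier (n 0) ((x.1 : ℝ) : UnitAddCircle) *
        fourier (n 1) ((x.2 : ℝ) : UnitAddCircle) ∂Q := fun Q => by
    rw [integral_map continuous_toTorus.measurable.aemeasurable
      (map_continuous _).aestronglyMeasurable]
    simp [UnitAddTorus.mFourier, toTorus, Fin.prod_univ_two]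
  rw [hmap, hmap, h]

end Torus

/-! ### Product structure from vanishing Fourier coefficients. -/

section Decomposition

variable {μ : Measure (I × I)} [IsProbabilityMeasure μ]

theorem ae_prod_ne_one {m m' : Measure I} [SFinite m] [SFinite m'] (h : m {1} = 0)
    (h' : m' {1} = 0) : ∀ᵐ x ∂m.prod m', x.1 ≠ 1 ∧ x.2 ≠ 1 :=
  (Measure.quasiMeasurePreserving_fst.ae (compl_mem_ae_iff.2 h)).and
    (Measure.quasiMeasurePreserving_snd.ae (compl_mem_ae_iff.2 h'))

theorem integrable_fourier_mul (Q : Measure (I × I)) [IsFiniteMeasure Q] (p q : ℤ) :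
    Integrable (fun x : I × I => fourier p ((x.1 : ℝ) : UnitAddCircle) *
      fourier q ((x.2 : ℝ) : UnitAddCircle)) Q := by
  refine Integrable.of_bound (C := 1) ?_ (Eventually.of_forall fun x => ?_)
  · refine Continuous.aestronglyMeasurable (Continuous.mul ?_ ?_)
    · exact (map_continuous _).comp
        ((AddCircle.continuous_mk' 1).comp (continuous_subtype_val.comp continuous_fst))
    · exact (map_continuous _).comp
        ((AddCircle.continuous_mk' 1).comp (continuous_subtype_val.comp continuous_snd))
  · rw [norm_mul, fourier_apply, fourier_apply, Circle.norm_coe, Circle.norm_coe, mul_one]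

theorem integral_fourier_prod (m m' : Measure I) [SFinite m] [SFinite m'] (p q : ℤ) :
    ∫ x, fourier p ((x.1 : ℝ) : UnitAddCircle) * fourier q ((x.2 : ℝ) : UnitAddCircle)
      ∂(m.prod m') = (∫ x, fourier p ((x : ℝ) : UnitAddCircle) ∂m) *
        ∫ x, fourier q ((x : ℝ) : UnitAddCircle) ∂m' :=
  integral_prod_mul (fun x : I => fourier p ((x : ℝ) : UnitAddCircle))
    (fun x : I => fourier q ((x : ℝ) : UnitAddCircle))

/-- Off the axes all four coefficients vanish; on them only the marginals matter. Placing λ×λ on the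
left avoids signed measures. -/
theorem add_prod_eq_of_integral_fourier (h1 : μ.map Prod.fst {1} = 0) (h2 : μ.map Prod.snd {1} = 0)
    (h : ∀ p q : ℤ, p ≠ 0 → q ≠ 0 →
      ∫ x, fourier p ((x.1 : ℝ) : UnitAddCircle) * fourier q ((x.2 : ℝ) : UnitAddCircle) ∂μ = 0) :
    μ + (volume : Measure I).prod volume =
      (μ.map Prod.fst).prod volume + (volume : Measure I).prod (μ.map Prod.snd) := by
  have : IsProbabilityMeasure (μ.map Prod.fst) :=
    Measure.isProbabilityMeasure_map measurable_fst.aemeasurable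
  have : IsProbabilityMeasure (μ.map Prod.snd) :=
    Measure.isProbabilityMeasure_map measurable_snd.aemeasurable
  have hv : (volume : Measure I) {1} = 0 := measure_singleton 1
  have hc : ∀ p, Continuous fun x : I => fourier p ((x : ℝ) : UnitAddCircle) := fun p =>
    (map_continuous _).comp ((AddCircle.continuous_mk' 1).comp continuous_subtype_val)
  have hfst : ∀ p, ∫ x, fourier p ((x : ℝ) : UnitAddCircle) ∂(μ.map Prod.fst) =
      ∫ x, fourier p ((x.1 : ℝ) : UnitAddCircle) ∂μ := fun p =>
    integral_map measurable_fst.aemeasurable (hc p).aestronglyMeasurable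
  have hsnd : ∀ p, ∫ x, fourier p ((x : ℝ) : UnitAddCircle) ∂(μ.map Prod.snd) =
      ∫ x, fourier p ((x.2 : ℝ) : UnitAddCircle) ∂μ := fun p =>
    integral_map measurable_snd.aemeasurable (hc p).aestronglyMeasurable
  refine ext_of_integral_fourier ?_ ?_ fun p q => ?_
  · rw [ae_add_measure_iff]
    refine ⟨?_, ae_prod_ne_one hv hv⟩
    rw [Measure.map_apply measurable_fst (measurableSet_singleton _)] at h1
    rw [Measure.map_apply measurable_snd (measurableSet_singleton _)] at h2
    exact (show ∀ᵐ x ∂μ, x.1 ≠ 1 from compl_mem_ae_iff.2 h1).and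
      (show ∀ᵐ x ∂μ, x.2 ≠ 1 from compl_mem_ae_iff.2 h2)
  · rw [ae_add_measure_iff]
    exact ⟨ae_prod_ne_one h1 hv, ae_prod_ne_one hv h2⟩
  · rw [integral_add_measure (integrable_fourier_mul _ p q) (integrable_fourier_mul _ p q),
      integral_add_measure (integrable_fourier_mul _ p q) (integrable_fourier_mul _ p q),
      integral_fourier_prod, integral_fourier_prod, integral_fourier_prod, hfst, hsnd]
    rcases eq_or_ne p 0 with rfl | hp
    · rcases eq_or_ne q 0 with rfl | hq
      · simp
      · rw [integral_fourier_volume hq]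
        simp only [fourier_zero, one_mul, mul_zero, integral_const, probReal_univ, one_smul,
          add_zero, zero_add]
    · rcases eq_or_ne q 0 with rfl | hq
      · rw [integral_fourier_volume hp]
        simp only [fourier_zero, mul_one, integral_const, probReal_univ, one_smul,
          add_zero]
      · rw [integral_fourier_volume hp, integral_fourier_volume hq, h p q hp hq]
        simp only [mul_zero, zero_mul]

theorem fst_eq_volume_or_snd_eq_volume {N : ℕ} (hN : 2 ≤ N)
    (h1 : Ergodic (timesMap N) (μ.map Prod.fst)) (h2 : Ergodic (timesMap N) (μ.map Prod.snd))
    (h : μ + (volume : Measure I).prod volume =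
      (μ.map Prod.fst).prod volume + (volume : Measure I).prod (μ.map Prod.snd)) :
    μ.map Prod.fst = volume ∨ μ.map Prod.snd = volume := by
  have : IsProbabilityMeasure (μ.map Prod.fst) :=
    Measure.isProbabilityMeasure_map measurable_fst.aemeasurable
  have : IsProbabilityMeasure (μ.map Prod.snd) :=
    Measure.isProbabilityMeasure_map measurable_snd.aemeasurable
  by_contra! hne
  obtain ⟨B, hBm, hB, hBv⟩ := exists_full_volume_null hN h1 hne.1
  obtain ⟨C, hCm, hC, hCv⟩ := exists_full_volume_null hN h2 hne.2
  rw [Measure.map_apply measurable_fst hBm.compl] at hB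
  rw [Measure.map_apply measurable_snd hCm.compl] at hC
  have h3 := congrArg (fun Q : Measure (I × I) => Q (B ×ˢ C)) h
  simp only [Measure.add_apply, Measure.prod_prod, hBv, hCv, mul_zero, zero_mul, add_zero] at h3
  have h4 : μ (B ×ˢ C)ᶜ = 0 := by
    rw [compl_prod_eq_union]
    refine measure_union_null ?_ ?_
    · refine measure_mono_null ?_ hB
      exact fun x hx => hx.1
    · refine measure_mono_null ?_ hC
      exact fun x hx => hx.2
  have h5 : μ univ = 0 := by
    rw [← union_compl_self (B ×ˢ C)]
    exact measure_union_null h3 h4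
  simp at h5

theorem eq_of_add_eq_add_left {α : Type*} [MeasurableSpace α] {P Q R : Measure α}
    [IsFiniteMeasure P] (h : P + Q = P + R) : Q = R := by
  ext s -
  have h1 := congrArg (fun M : Measure α => M s) h
  simp only [Measure.add_apply] at h1
  exact (ENNReal.add_right_inj (measure_ne_top P s)).1 h1

end Decomposition

/-! ### Absolute continuity of projections of products. -/

section Converse

/-- For fixed x₁ the projection is affine in x₂ with slope v₂ ≠ 0, so null sets pull back to sets
with null slices. -/
theorem map_proj_prod_absolutelyContinuous {ν : Measure I} [SFinite ν] {v : ℝ × ℝ}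
    (hv : v.2 ≠ 0) : (ν.prod (volume : Measure I)).map (proj v) ≪ volume := by
  refine Measure.AbsolutelyContinuous.mk fun S hS h0 => ?_
  rw [Measure.map_apply (measurable_proj v) hS,
    Measure.measure_prod_null (measurable_proj v hS)]
  refine Eventually.of_forall fun x => ?_
  change volume (Prod.mk x ⁻¹' (proj v ⁻¹' S)) = 0
  rw [unitInterval.volume_apply]
  refine measure_mono_null (t := (fun t : ℝ => t * v.2) ⁻¹' ((fun t => (x : ℝ) * v.1 + t) ⁻¹' S))
    ?_ ?_
  · rintro _ ⟨y, hy, rfl⟩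
    exact hy
  · rw [Real.volume_preimage_mul_right hv, measure_preimage_add, h0, mul_zero]

theorem measureDimH_eq_one_of_absolutelyContinuous {m : Measure ℝ} [IsProbabilityMeasure m]
    (h : m ≪ volume) : measureDimH m = 1 := by
  refine le_antisymm ?_ ?_
  · exact (iInf₂_le_of_le univ MeasurableSet.univ (iInf_le _ (by simp))).trans_eq
      Real.dimH_univ
  · refine le_iInf fun A => le_iInf₂ fun _ hpos => ?_
    by_contra! hA
    refine hpos.ne' (h ?_)
    rw [← hausdorffMeasure_real]
    simpa using hausdorffMeasure_of_dimH_lt (X := ℝ) (s := A) (d := 1) (by simpa using hA)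

theorem map_proj_swap (P : Measure (I × I)) (v : ℝ × ℝ) :
    (P.map Prod.swap).map (proj v) = P.map (proj v.swap) := by
  rw [Measure.map_map (measurable_proj v) measurable_swap]
  congr 1
  funext x
  simp [proj, add_comm]

end Converse

/-- The coordinate swap of the square, as an isometry. -/
def swapIsometry : I × I ≃ᵢ I × I where
  toEquiv := Equiv.prodComm I I
  isometry_toFun x y := by simp [Prod.edist_eq, max_comm]

end TimesN

theorem mainTheorem8 (N : ℕ) (hN : 2 ≤ N) (μ : Measure (I × I)) [IsProbabilityMeasure μ]
    (hμ : Ergodic (TimesN.timesMap₂ N) μ) (hdim : TimesN.measureDimH μ = 1) :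
    (∀ v : ℝ × ℝ, TimesN.NonPrincipal v → TimesN.measureDimH (μ.map (TimesN.proj v)) = 1) ↔
      ∃ ν : Measure I, IsProbabilityMeasure ν ∧ Ergodic (TimesN.timesMap N) ν ∧
        TimesN.measureDimH ν = 0 ∧
        (μ = ν.prod (volume : Measure I) ∨ μ = (volume : Measure I).prod ν) := by
  constructor
  · intro h
    have hP1 : IsProbabilityMeasure (μ.map Prod.fst) :=
      Measure.isProbabilityMeasure_map measurable_fst.aemeasurable
    have hP2 : IsProbabilityMeasure (μ.map Prod.snd) :=
      Measure.isProbabilityMeasure_map measurable_snd.aemeasurable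
    have h1 : Ergodic (TimesN.timesMap N) (μ.map Prod.fst) :=
      (measurable_fst.measurePreserving μ).ergodic_of_ergodic_semiconj hμ
        (TimesN.measurable_timesMap N) (fun _ => rfl)
    have h2 : Ergodic (TimesN.timesMap N) (μ.map Prod.snd) :=
      (measurable_snd.measurePreserving μ).ergodic_of_ergodic_semiconj hμ
        (TimesN.measurable_timesMap N) (fun _ => rfl)
    have hadd := TimesN.add_prod_eq_of_integral_fourier
      (TimesN.measure_singleton_one h1.toMeasurePreserving)
      (TimesN.measure_singleton_one h2.toMeasurePreserving) fun p q hp hq =>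
        TimesN.integral_fourier_combMod (TimesN.map_combMod_eq_volume hN hμ.toMeasurePreserving
          (h _ (mul_ne_zero (Int.cast_ne_zero.2 hp) (Int.cast_ne_zero.2 hq))).ge)
    rcases TimesN.fst_eq_volume_or_snd_eq_volume hN h1 h2 hadd with h3 | h3
    · have h4 : μ = (volume : Measure I).prod (μ.map Prod.snd) := by
        rw [h3, add_comm] at hadd
        exact TimesN.eq_of_add_eq_add_left hadd
      exact ⟨_, hP2, h2, TimesN.measureDimH_eq_zero_of_volume_prod (h4 ▸ hdim.le), Or.inr h4⟩
    · have h4 : μ = (μ.map Prod.fst).prod (volume : Measure I) := by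
        rw [h3, add_comm μ, add_comm (Measure.prod (μ.map _) _)] at hadd
        exact TimesN.eq_of_add_eq_add_left hadd
      refine ⟨_, hP1, h1, TimesN.measureDimH_eq_zero_of_volume_prod ?_, Or.inl h4⟩
      -- The slicing bound needs λ as first factor; the coordinate swap is an isometry, so the
      -- dimension bound carries over.
      rw [← Measure.prod_swap, ← h4, ← hdim]
      have := TimesN.measureDimH_map_isometryEquiv TimesN.swapIsometry (μ.map Prod.swap)
      rwa [Measure.map_map TimesN.swapIsometry.continuous.measurable measurable_swap,
        show ⇑TimesN.swapIsometry ∘ Prod.swap = id from rfl, Measure.map_id] at this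
  · rintro ⟨ν, hν, -, -, h⟩ v hv
    have : IsProbabilityMeasure (μ.map (TimesN.proj v)) :=
      Measure.isProbabilityMeasure_map (TimesN.measurable_proj v).aemeasurable
    refine TimesN.measureDimH_eq_one_of_absolutelyContinuous ?_
    rcases h with rfl | rfl
    · exact TimesN.map_proj_prod_absolutelyContinuous (right_ne_zero_of_mul hv)
    · rw [← Measure.prod_swap, TimesN.map_proj_swap]
      exact TimesN.map_proj_prod_absolutelyContinuous (left_ne_zero_of_mul hv)
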